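/- **Theorem.** Let $(Q,d)$ be a Hadamard space, i.e. a complete metric space such that for all $y_0,y_1\in Q$ there is $p\in Q$ with $d(q,p)^2\le\frac12 d(y_0,q)^2+\frac12 d(y_1,q)^2-\frac14 d(y_0,y_1)^2$ for all $q\in Q$. Equip $Q$ with its Borel $\sigma$-algebra. Let $\tau\colon[0,\infty)\to\mathbb R$ be nondecreasing and convex with $\tau(0)=0$, differentiable on $(0,\infty)$ with concave derivative $\tau'$ and $\tau'>0$ on $(0,\infty)$; put $\tau'(0):=\lim_{x\searrow0}\tau'(x)$. Let $\tau''_+(x):=\lim_{y\searrow x}\frac{\tau'(y)-\tau'(x)}{y-x}$, $x\ge0$, denote the right derivative of $\tau'$ (with $\tau''_+(0)\in[0,\infty]$). Let $Y$ be a $Q$-valued random variable whose distribution is carried by a separable subset of $Q$ (automatic if $Q$ is separable). Let $m$ be a $\tau$-Fréchet mean of $Y$, i.e. a minimizer of $q\mapsto\mathbb E[\tau(d(Y,q))-\tau(d(Y,o))]$ over $q \in Q$, for a reference point $o\in Q$ (the choice of which is irrelevant). Assume that $\limsup_{x\to\infty}\tau'(x)<\infty$, that $\tau''_+(x)>0$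 for all $x>0$, and that $\mathbb E[d(Y,m)^\gamma]<\infty$ for some $\gamma>0$. Then there are $n_0\in\mathbb N$ and $C\in(0,\infty)$, depending only on $\tau$, $\gamma$ and the distribution of $Y$, such that for all $n\ge n_0$, all independent copies $Y_1,\dots,Y_n$ of $Y$, every $m_n\in\arg\min_{q\in Q}\sum_{j=1}^n\tau(d(Y_j,q))$ and every median $\chi$ of $d(Y,m)$, the following expectation exists and $$\mathbb E\Big[d(m,m_n)^2\,\min\big(\tau''_+(2\chi),\,\tau''_+(2\,d(m,m_n))\big)\Big]\le\frac Cn ,$$ where the integrand is $0$ if $m_n=m$. -/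

import Mathlib

open MeasureTheory ProbabilityTheory Filter Topology Set

noncomputable section

namespace TransformedFrechet

/-- Hadamard spaces: complete metric spaces in which every pair of points `y₀, y₁` has a
midpoint `m` satisfying the CN inequality against every point `q`. -/
def IsHadamard (Q : Type*) [MetricSpace Q] : Prop :=
  CompleteSpace Q ∧ ∀ y₀ y₁ : Q, ∃ m : Q, ∀ q : Q,
    dist q m ^ 2 ≤ (1 / 2) * dist y₀ q ^ 2 + (1 / 2) * dist y₁ q ^ 2 - (1 / 4) * dist y₀ y₁ ^ 2

/-- The transformations: nondecreasing convex functions on `[0, ∞)`, differentiable on `(0, ∞)`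
with concave derivative, normalised by `τ 0 = 0` and with `τ' > 0` on `(0, ∞)`.
The values of `τ` at negative arguments play no role. -/
structure IsTransformation (τ : ℝ → ℝ) : Prop where
  monotoneOn : MonotoneOn τ (Ici 0)
  convexOn : ConvexOn ℝ (Ici 0) τ
  differentiableAt : ∀ x : ℝ, 0 < x → DifferentiableAt ℝ τ x
  concaveOn_deriv : ConcaveOn ℝ (Ioi 0) (deriv τ)
  map_zero : τ 0 = 0
  deriv_pos : ∀ x : ℝ, 0 < x → 0 < deriv τ x

/-- The derivative `τ'` on `[0, ∞)`, where `τ'(0)` is the limit of `τ'(x)` as `x` decreases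
to `0` (the limit exists for every transformation). -/
def dtran (τ : ℝ → ℝ) (x : ℝ) : ℝ :=
  if 0 < x then deriv τ x else limUnder (𝓝[>] (0 : ℝ)) (deriv τ)

/-- The right derivative of `f` at `x`, as an extended real. -/
def rightDeriv (f : ℝ → ℝ) (x : ℝ) : EReal :=
  limUnder (𝓝[>] x) (fun y : ℝ => (((f y - f x) / (y - x) : ℝ) : EReal))

/-- The right derivative `τ''₊` of `τ'` on `[0, ∞)`; its value at `0` may be `+∞`. -/
def ddtran (τ : ℝ → ℝ) (x : ℝ) : EReal := rightDeriv (dtran τ) x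

/-- `m` is a `τ`-Fréchet mean of the distribution `μ`: it minimises
`q ↦ E[τ(d(Y, q)) - τ(d(Y, o))]`, `Y ∼ μ`. The set of minimisers does not depend on the
reference point `o`, and the expectations are finite whenever `E[τ'(d(Y, o))] < ∞`, in particular
whenever `τ'` is bounded. -/
def IsFrechetMean {Q : Type*} [MetricSpace Q] [MeasurableSpace Q]
    (τ : ℝ → ℝ) (μ : Measure Q) (m : Q) : Prop :=
  ∃ o : Q, IsMinOn (fun q : Q => ∫ y, (τ (dist y q) - τ (dist y o)) ∂μ) univ m

/-- `p` is a sample `τ`-Fréchet mean of `y₁, …, yₙ`. -/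
def IsSampleFrechetMean {Q : Type*} [MetricSpace Q] {n : ℕ}
    (τ : ℝ → ℝ) (y : Fin n → Q) (p : Q) : Prop :=
  IsMinOn (fun q : Q => ∑ j, τ (dist (y j) q)) univ p

/-- `χ` is a median of the probability distribution `ν` on the real line. -/
def IsMedian (ν : Measure ℝ) (χ : ℝ) : Prop :=
  1 / 2 ≤ ν (Iic χ) ∧ 1 / 2 ≤ ν (Ici χ)

end TransformedFrechet

end

/-! Let R(q) = E[τ(d(Y,q)) - τ(d(Y,m))] be the excess risk. The theorem follows from a deterministic
inequality for R and a bound of order 1/n on E[R(m_n)].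

Variance inequality: where τ' has slope at least w, τ(x) - (w/2)x² is still nondecreasing and
convex, so the CN inequality becomes strong midpoint convexity of q ↦ τ(d(y,q)). Integrating this
over the ball of radius χ about m, which has mass at least 1/2, and using minimality of m gives
d(m,q)² w ≤ 8 R(q), with w the minimum in the theorem (`IsFrechetMean.sq_dist_mul_ddtran_le`).

Rate: add one observation. Since Y_i is independent of the minimizer m_{-i} of the others, E[R(m_n)]
= E[τ(d(Y_i,m_{-i})) - τ(d(Y_i,m))] for each i. Summed over i, m may be replaced by the full
minimizer, which does at least as well; as τ' ≤ L, only the displacement of the minimizer under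
deletion of one point remains (`integral_excessRisk_le`). If most observations lie in a fixed ball,
strong convexity makes this displacement O(1/n) (`IsHadamard.dist_leaveOneOut_le`).

Otherwise ∏ (1 + c d(Y_j,m)^γ) is large, and its expectation factorizes. For a small fixed c this
makes the bad case contribute an exponentially small amount. For c = 1/n the expectation stays
bounded while the product dominates d(m,m_n)² (`sq_dist_le_momentProd`), so a moment of any order γ
> 0 suffices. -/

namespace TransformedFrechet

/-- The derivative of `τ` grows with slope at least `w` on `(0, M]`. -/
def CurvatureBound (τ : ℝ → ℝ) (w M : ℝ) : Prop :=
  ∀ x y : ℝ, 0 < x → x < y → y ≤ M → w * (y - x) ≤ deriv τ y - deriv τ x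

theorem CurvatureBound.mono {τ : ℝ → ℝ} {w w' M M' : ℝ} (h : CurvatureBound τ w M)
    (hw : w' ≤ w) (hM : M' ≤ M) : CurvatureBound τ w' M' := fun x y hx hxy hy =>
  (mul_le_mul_of_nonneg_right hw (sub_nonneg.2 hxy.le)).trans (h x y hx hxy (hy.trans hM))

/-! ### Calculus of transformations and their curvature -/

namespace IsTransformation

variable {τ : ℝ → ℝ}

theorem monotoneOn_deriv (hτ : IsTransformation τ) : MonotoneOn (deriv τ) (Ioi 0) :=
  (hτ.convexOn.subset Ioi_subset_Ici_self (convex_Ioi 0)).monotoneOn_deriv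
    fun x hx => hτ.differentiableAt x hx

theorem curvatureBound_zero (hτ : IsTransformation τ) (M : ℝ) : CurvatureBound τ 0 M := by
  intro x y hx hxy _
  have := hτ.monotoneOn_deriv (mem_Ioi.2 hx) (mem_Ioi.2 (hx.trans hxy)) hxy.le
  linarith

theorem nonneg (hτ : IsTransformation τ) {x : ℝ} (hx : 0 ≤ x) : 0 ≤ τ x := by
  simpa [hτ.map_zero] using hτ.monotoneOn self_mem_Ici (mem_Ici.2 hx) hx

theorem continuousOn (hτ : IsTransformation τ) : ContinuousOn τ (Ici 0) := by
  intro x hx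
  rcases (mem_Ici.1 hx).eq_or_lt with rfl | hx
  · have h1 : ∀ᶠ y in 𝓝[≥] (0 : ℝ), τ y ≤ y * τ 1 := by
      filter_upwards [Icc_mem_nhdsGE (zero_lt_one' ℝ)] with y hy
      have := hτ.convexOn.2 (mem_Ici.2 le_rfl) (mem_Ici.2 zero_le_one)
        (sub_nonneg.2 hy.2) hy.1 (by ring)
      simpa [hτ.map_zero] using this
    have h2 : ∀ᶠ y in 𝓝[≥] (0 : ℝ), 0 ≤ τ y := by
      filter_upwards [self_mem_nhdsWithin] with y hy using hτ.nonneg hy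
    have h3 : Tendsto (fun y : ℝ => y * τ 1) (𝓝[≥] 0) (𝓝 0) := by
      have : Tendsto (fun y : ℝ => y * τ 1) (𝓝 0) (𝓝 (0 * τ 1)) :=
        (continuous_id.mul continuous_const).tendsto 0
      rw [zero_mul] at this
      exact this.mono_left nhdsWithin_le_nhds
    rw [ContinuousWithinAt, hτ.map_zero]
    exact tendsto_of_tendsto_of_tendsto_of_le_of_le' tendsto_const_nhds h3 h2 h1
  · exact (hτ.differentiableAt x hx).continuousAt.continuousWithinAt

theorem sub_le_mul (hτ : IsTransformation τ) {L : ℝ} (hL : ∀ x, 0 < x → deriv τ x ≤ L)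
    {a b : ℝ} (ha : 0 ≤ a) (hab : a ≤ b) : τ b - τ a ≤ L * (b - a) := by
  rcases hab.eq_or_lt with rfl | hlt
  · simp
  · have hb : 0 < b := ha.trans_lt hlt
    have h := hτ.convexOn.slope_le_deriv (mem_Ici.2 ha) (mem_Ici.2 hb.le) hlt
      (hτ.differentiableAt b hb)
    rw [slope_def_field] at h
    exact (div_le_iff₀ (sub_pos.2 hlt)).1 (h.trans (hL b hb))

theorem abs_sub_le_mul (hτ : IsTransformation τ) {L : ℝ} (hL : ∀ x, 0 < x → deriv τ x ≤ L)
    {a b : ℝ} (ha : 0 ≤ a) (hb : 0 ≤ b) : |τ a - τ b| ≤ L * |a - b| := by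
  rcases le_total a b with h | h
  · rw [abs_sub_comm, abs_sub_comm a, abs_of_nonneg (sub_nonneg.2 h),
      abs_of_nonneg (sub_nonneg.2 (hτ.monotoneOn (mem_Ici.2 ha) (mem_Ici.2 hb) h))]
    exact hτ.sub_le_mul hL ha h
  · rw [abs_of_nonneg (sub_nonneg.2 h),
      abs_of_nonneg (sub_nonneg.2 (hτ.monotoneOn (mem_Ici.2 hb) (mem_Ici.2 ha) h))]
    exact hτ.sub_le_mul hL hb h

theorem deriv_one_mul_le (hτ : IsTransformation τ) {a b : ℝ} (ha : 1 ≤ a) (hab : a ≤ b) :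
    deriv τ 1 * (b - a) ≤ τ b - τ a := by
  rcases hab.eq_or_lt with rfl | hlt
  · simp
  · have ha0 : 0 < a := one_pos.trans_le ha
    have h := hτ.convexOn.deriv_le_slope (mem_Ici.2 ha0.le) (mem_Ici.2 (ha0.trans hlt).le) hlt
      (hτ.differentiableAt a ha0)
    rw [slope_def_field] at h
    exact (le_div_iff₀ (sub_pos.2 hlt)).1
      ((hτ.monotoneOn_deriv (mem_Ioi.2 one_pos) (mem_Ioi.2 ha0) ha).trans h)

theorem mul_le_deriv (hτ : IsTransformation τ) {w M : ℝ} (h : CurvatureBound τ w M)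
    {x : ℝ} (hx : 0 < x) (hxM : x ≤ M) : w * x ≤ deriv τ x := by
  have h1 : ∀ᶠ y in 𝓝[>] (0 : ℝ), w * (x - y) ≤ deriv τ x := by
    filter_upwards [Ioo_mem_nhdsGT hx] with y hy
    linarith [h y x hy.1 hy.2 hxM, hτ.deriv_pos y hy.1]
  have h2 : Tendsto (fun y : ℝ => w * (x - y)) (𝓝[>] 0) (𝓝 (w * (x - 0))) :=
    ((continuous_const.mul (continuous_const.sub continuous_id)).tendsto 0).mono_left
      nhdsWithin_le_nhds
  simpa using le_of_tendsto h2 h1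

theorem hasDerivAt_sub_sq (hτ : IsTransformation τ) (w : ℝ) {x : ℝ} (hx : 0 < x) :
    HasDerivAt (fun x => τ x - w / 2 * x ^ 2) (deriv τ x - w * x) x := by
  have := (hτ.differentiableAt x hx).hasDerivAt.sub ((hasDerivAt_pow 2 x).const_mul (w / 2))
  refine this.congr_deriv ?_
  norm_num
  ring

/-- Used with the convexity below in `midpoint_le`: monotonicity passes from s to (a + b)/2,
convexity splits that mean, and the CN inequality handles the quadratic part. -/
theorem monotoneOn_sub_sq (hτ : IsTransformation τ) {w M : ℝ} (h : CurvatureBound τ w M) :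
    MonotoneOn (fun x => τ x - w / 2 * x ^ 2) (Icc 0 M) := by
  refine monotoneOn_of_deriv_nonneg (convex_Icc 0 M)
    ((hτ.continuousOn.mono Icc_subset_Ici_self).sub (by fun_prop)) ?_ ?_
  · rw [interior_Icc]
    exact fun x hx => (hτ.hasDerivAt_sub_sq w hx.1).differentiableAt.differentiableWithinAt
  · rw [interior_Icc]
    intro x hx
    rw [(hτ.hasDerivAt_sub_sq w hx.1).deriv]
    exact sub_nonneg.2 (hτ.mul_le_deriv h hx.1 hx.2.le)

theorem convexOn_sub_sq (hτ : IsTransformation τ) {w M : ℝ} (h : CurvatureBound τ w M) :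
    ConvexOn ℝ (Icc 0 M) (fun x => τ x - w / 2 * x ^ 2) := by
  refine MonotoneOn.convexOn_of_deriv (convex_Icc 0 M)
    ((hτ.continuousOn.mono Icc_subset_Ici_self).sub (by fun_prop)) ?_ ?_
  · rw [interior_Icc]
    exact fun x hx => (hτ.hasDerivAt_sub_sq w hx.1).differentiableAt.differentiableWithinAt
  · rw [interior_Icc]
    intro x hx y hy hxy
    rw [(hτ.hasDerivAt_sub_sq w hx.1).deriv, (hτ.hasDerivAt_sub_sq w hy.1).deriv]
    rcases hxy.eq_or_lt with rfl | hlt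
    · rfl
    · linarith [h x y hx.1 hlt hy.2.le]

/-- Strong midpoint convexity of `τ ∘ d` along the comparison inequality of Hadamard spaces. -/
theorem midpoint_le (hτ : IsTransformation τ) {w M a b s D : ℝ} (h : CurvatureBound τ w M)
    (hw : 0 ≤ w) (ha : 0 ≤ a) (hb : 0 ≤ b) (haM : a ≤ M) (hbM : b ≤ M) (hs : 0 ≤ s)
    (hab : |a - b| ≤ D) (hsq : s ^ 2 ≤ 1 / 2 * a ^ 2 + 1 / 2 * b ^ 2 - 1 / 4 * D ^ 2) :
    τ s ≤ 1 / 2 * τ a + 1 / 2 * τ b - w / 8 * D ^ 2 := by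
  -- Replacing D² by (a - b)² in the CN inequality leaves s² ≤ ((a + b)/2)².
  have hD : (a - b) ^ 2 ≤ D ^ 2 := sq_le_sq' (by linarith [abs_le.1 hab |>.1]) (abs_le.1 hab).2
  have hsu : s ≤ 1 / 2 * a + 1 / 2 * b := by
    apply le_of_sq_le_sq _ (by positivity)
    nlinarith
  have h1 := hτ.monotoneOn_sub_sq h (⟨hs, by linarith⟩ : s ∈ Icc 0 M)
    (⟨by positivity, by linarith⟩ : 1 / 2 * a + 1 / 2 * b ∈ Icc 0 M) hsu
  have h2 := (hτ.convexOn_sub_sq h).2 (⟨ha, haM⟩ : a ∈ Icc 0 M) (⟨hb, hbM⟩ : b ∈ Icc 0 M)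
    (by norm_num : (0 : ℝ) ≤ 1 / 2) (by norm_num : (0 : ℝ) ≤ 1 / 2) (by norm_num)
  simp only [smul_eq_mul] at h1 h2
  have h3 := mul_le_mul_of_nonneg_left hsq (by positivity : 0 ≤ w / 2)
  linarith

theorem dtran_of_pos {x : ℝ} (hx : 0 < x) : dtran τ x = deriv τ x := if_pos hx

theorem tendsto_dtran_zero (hτ : IsTransformation τ) :
    Tendsto (deriv τ) (𝓝[>] 0) (𝓝 (dtran τ 0)) := by
  have h : Tendsto (deriv τ) (𝓝[>] 0) (𝓝 (sInf (deriv τ '' Ioi 0))) :=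
    hτ.monotoneOn_deriv.tendsto_nhdsGT ⟨0, by
      rintro _ ⟨x, hx, rfl⟩
      exact (hτ.deriv_pos x hx).le⟩
  rw [dtran, if_neg (lt_irrefl _)]
  exact h.limUnder_eq.symm ▸ h

/-- Concavity is given only on the open half-line; base point 0 is reached by letting e ↘ 0 in
slopes based at e. -/
theorem slope_dtran_antitoneOn (hτ : IsTransformation τ) {x : ℝ} (hx : 0 ≤ x) :
    AntitoneOn (fun y => (dtran τ y - dtran τ x) / (y - x)) (Ioi x) := by
  have key : ∀ x, 0 < x → ∀ y z, x < y → y ≤ z →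
      (deriv τ z - deriv τ x) / (z - x) ≤ (deriv τ y - deriv τ x) / (y - x) := by
    intro x hx y z hxy hyz
    have := hτ.concaveOn_deriv.neg.secant_mono (mem_Ioi.2 hx) (mem_Ioi.2 (hx.trans hxy))
      (mem_Ioi.2 (hx.trans (hxy.trans_le hyz))) hxy.ne' (hxy.trans_le hyz).ne' hyz
    simp only [Pi.neg_apply] at this
    rw [show -deriv τ y - -deriv τ x = -(deriv τ y - deriv τ x) by ring,
      show -deriv τ z - -deriv τ x = -(deriv τ z - deriv τ x) by ring, neg_div, neg_div] at this
    exact neg_le_neg_iff.1 this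
  intro y hy z hz hyz
  have hxy : x < y := hy
  have hxz : x < z := hz
  simp only
  rw [dtran_of_pos (hx.trans_lt hxy), dtran_of_pos (hx.trans_lt hxz)]
  rcases hx.eq_or_lt with rfl | hx
  · have T : ∀ z : ℝ, 0 < z → Tendsto (fun e => (deriv τ z - deriv τ e) / (z - e)) (𝓝[>] 0)
        (𝓝 ((deriv τ z - dtran τ 0) / (z - 0))) := fun z hz =>
      (tendsto_const_nhds.sub hτ.tendsto_dtran_zero).div
        (((continuous_const.sub continuous_id).tendsto (0 : ℝ)).mono_left nhdsWithin_le_nhds)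
        (by simpa using hz.ne')
    refine le_of_tendsto_of_tendsto (T z hxz) (T y hxy) ?_
    filter_upwards [Ioo_mem_nhdsGT hxy] with e he using key e he.1 y z he.2 hyz
  · rw [dtran_of_pos hx]
    exact key x hx y z hxy hyz

/-- The slopes increase as y ↘ x, so their limit exists in `EReal` and is the supremum. This gives
the `limUnder` in `rightDeriv` its meaning, also when the value is ⊤. -/
theorem ddtran_eq_sSup (hτ : IsTransformation τ) {x : ℝ} (hx : 0 ≤ x) :
    ddtran τ x =
      sSup ((fun y : ℝ => (((dtran τ y - dtran τ x) / (y - x) : ℝ) : EReal)) '' Ioi x) := by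
  refine Tendsto.limUnder_eq (AntitoneOn.tendsto_nhdsGT ?_ (OrderTop.bddAbove _))
  exact fun y hy z hz hyz => EReal.coe_le_coe_iff.2 (hτ.slope_dtran_antitoneOn hx hy hz hyz)

theorem dtran_zero_le (hτ : IsTransformation τ) {x : ℝ} (hx : 0 < x) :
    dtran τ 0 ≤ deriv τ x := by
  refine le_of_tendsto hτ.tendsto_dtran_zero ?_
  filter_upwards [Ioo_mem_nhdsGT hx] with e he
  exact hτ.monotoneOn_deriv (mem_Ioi.2 he.1) (mem_Ioi.2 hx) he.2.le

theorem ddtran_nonneg (hτ : IsTransformation τ) {x : ℝ} (hx : 0 ≤ x) : 0 ≤ ddtran τ x := by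
  rw [hτ.ddtran_eq_sSup hx]
  have h1 : x < x + 1 := by linarith
  refine le_trans ?_ (le_sSup (mem_image_of_mem _ (mem_Ioi.2 h1)))
  rw [EReal.coe_nonneg]
  refine div_nonneg (sub_nonneg.2 ?_) (by linarith)
  rw [dtran_of_pos (hx.trans_lt h1)]
  rcases hx.eq_or_lt with rfl | hx
  · exact hτ.dtran_zero_le h1
  · rw [dtran_of_pos hx]
    exact hτ.monotoneOn_deriv (mem_Ioi.2 hx) (mem_Ioi.2 (hx.trans h1)) h1.le

theorem ddtran_le_slope (hτ : IsTransformation τ) {x y : ℝ} (hx : 0 < x) (hxy : x < y) :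
    ddtran τ y ≤ (((deriv τ y - deriv τ x) / (y - x) : ℝ) : EReal) := by
  rw [hτ.ddtran_eq_sSup (hx.trans hxy).le]
  refine sSup_le ?_
  rintro _ ⟨z, hz, rfl⟩
  have hyz : y < z := hz
  simp only
  rw [EReal.coe_le_coe_iff, dtran_of_pos (hx.trans hxy), dtran_of_pos (hx.trans (hxy.trans hyz))]
  exact hτ.concaveOn_deriv.slope_anti_adjacent (mem_Ioi.2 hx)
    (mem_Ioi.2 (hx.trans (hxy.trans hyz))) hxy hyz

theorem slope_le_ddtran (hτ : IsTransformation τ) {x y : ℝ} (hx : 0 < x) (hxy : x < y) :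
    (((deriv τ y - deriv τ x) / (y - x) : ℝ) : EReal) ≤ ddtran τ x := by
  rw [hτ.ddtran_eq_sSup hx.le]
  refine le_sSup ⟨y, hxy, ?_⟩
  simp only [dtran_of_pos hx, dtran_of_pos (hx.trans hxy)]

theorem ddtran_antitoneOn (hτ : IsTransformation τ) : AntitoneOn (ddtran τ) (Ioi 0) := by
  intro x hx y hy hxy
  rcases hxy.eq_or_lt with rfl | hlt
  · rfl
  · exact (hτ.ddtran_le_slope hx hlt).trans (hτ.slope_le_ddtran hx hlt)

theorem ddtran_lt_top (hτ : IsTransformation τ) {x : ℝ} (hx : 0 < x) : ddtran τ x < ⊤ :=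
  (hτ.ddtran_le_slope (half_pos hx) (half_lt_self hx)).trans_lt (EReal.coe_lt_top _)

/-- As τ''₊ is nonincreasing on (0, ∞), its value at M bounds all slopes of τ' on (0, M] from below.
-/
theorem curvatureBound (hτ : IsTransformation τ) {w M : ℝ} (hM : 0 < M)
    (hw : (w : EReal) ≤ ddtran τ M) : CurvatureBound τ w M := by
  intro x y hx hxy hyM
  have h := (hw.trans (hτ.ddtran_antitoneOn (mem_Ioi.2 (hx.trans hxy)) (mem_Ioi.2 hM) hyM)).trans
    (hτ.ddtran_le_slope hx hxy)
  exact (le_div_iff₀ (sub_pos.2 hxy)).1 (EReal.coe_le_coe_iff.1 h)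

theorem exists_curvatureBound_pos (hτ : IsTransformation τ)
    (hpos : ∀ x : ℝ, 0 < x → 0 < ddtran τ x) (M : ℝ) : ∃ w, 0 < w ∧ CurvatureBound τ w M := by
  have hM : 0 < max M 1 := lt_max_of_lt_right one_pos
  obtain ⟨w, hw0, hw⟩ := EReal.lt_iff_exists_real_btwn.1 (hpos _ hM)
  exact ⟨w, EReal.coe_pos.1 hw0, (hτ.curvatureBound hM hw.le).mono le_rfl (le_max_left _ _)⟩

theorem exists_deriv_le (hτ : IsTransformation τ)
    (hbdd : limsup (fun x : ℝ => ((dtran τ x : ℝ) : EReal)) atTop < ⊤) :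
    ∃ L, 0 < L ∧ ∀ x, 0 < x → deriv τ x ≤ L := by
  obtain ⟨L, hL, -⟩ := EReal.lt_iff_exists_real_btwn.1 hbdd
  have h := eventually_lt_of_limsup_lt hL
  have key : ∀ x, 0 < x → deriv τ x ≤ L := by
    intro x hx
    obtain ⟨y, hy1, hy2⟩ := (h.and (eventually_ge_atTop x)).exists
    have hy := EReal.coe_lt_coe_iff.1 hy1
    rw [dtran_of_pos (hx.trans_le hy2)] at hy
    exact (hτ.monotoneOn_deriv (mem_Ioi.2 hx) (mem_Ioi.2 (hx.trans_le hy2)) hy2).trans hy.le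
  exact ⟨L, (hτ.deriv_pos 1 one_pos).trans_le (key 1 one_pos), key⟩

end IsTransformation

end TransformedFrechet

/-! ### Sample minimizers: existence, uniqueness, stability -/

namespace TransformedFrechet

variable {Q : Type*} [MetricSpace Q] {ι : Type*} [Fintype ι] {τ : ℝ → ℝ}

/-- The sample objective function. -/
def sampleSum (τ : ℝ → ℝ) (y : ι → Q) (q : Q) : ℝ := ∑ j, τ (dist (y j) q)

/-- The point p serves all y at once while w and M may depend on y, so the inequality can be summed
or integrated with w = 0 at outliers. -/
theorem IsHadamard.exists_midpoint (hQ : IsHadamard Q) (hτ : IsTransformation τ) (q₀ q₁ : Q) :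
    ∃ p : Q, ∀ (y : Q) (w M : ℝ), CurvatureBound τ w M → 0 ≤ w → dist y q₀ ≤ M →
      dist y q₁ ≤ M →
      τ (dist y p) ≤ 1 / 2 * τ (dist y q₀) + 1 / 2 * τ (dist y q₁) - w / 8 * dist q₀ q₁ ^ 2 := by
  obtain ⟨p, hp⟩ := hQ.2 q₀ q₁
  refine ⟨p, fun y w M h hw h0 h1 => hτ.midpoint_le h hw dist_nonneg dist_nonneg h0 h1
    dist_nonneg ?_ ?_⟩
  · rw [dist_comm y q₀, dist_comm y q₁]
    exact abs_dist_sub_le q₀ q₁ y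
  · rw [dist_comm y q₀, dist_comm y q₁]
    exact hp y

theorem IsHadamard.exists_sampleSum_midpoint (hQ : IsHadamard Q) (hτ : IsTransformation τ)
    (y : ι → Q) (q₀ q₁ : Q) (w M : ι → ℝ) (h : ∀ j, CurvatureBound τ (w j) (M j))
    (hw : ∀ j, 0 ≤ w j) (h0 : ∀ j, dist (y j) q₀ ≤ M j) (h1 : ∀ j, dist (y j) q₁ ≤ M j) :
    ∃ p : Q, (∑ j, w j) / 8 * dist q₀ q₁ ^ 2 ≤
      1 / 2 * sampleSum τ y q₀ + 1 / 2 * sampleSum τ y q₁ - sampleSum τ y p := by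
  obtain ⟨p, hp⟩ := hQ.exists_midpoint hτ q₀ q₁
  refine ⟨p, ?_⟩
  have := Finset.sum_le_sum fun j (_ : j ∈ Finset.univ) =>
    hp (y j) (w j) (M j) (h j) (hw j) (h0 j) (h1 j)
  rw [Finset.sum_sub_distrib, Finset.sum_add_distrib, ← Finset.mul_sum, ← Finset.mul_sum,
    ← Finset.sum_mul, ← Finset.sum_div] at this
  simp only [sampleSum]
  linarith

theorem IsHadamard.growth_of_isMinOn (hQ : IsHadamard Q) (hτ : IsTransformation τ)
    {y : ι → Q} {p : Q} (hp : IsMinOn (sampleSum τ y) univ p) (q : Q) (w M : ι → ℝ)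
    (h : ∀ j, CurvatureBound τ (w j) (M j)) (hw : ∀ j, 0 ≤ w j)
    (h0 : ∀ j, dist (y j) p ≤ M j) (h1 : ∀ j, dist (y j) q ≤ M j) :
    (∑ j, w j) / 4 * dist p q ^ 2 ≤ sampleSum τ y q - sampleSum τ y p := by
  obtain ⟨r, hr⟩ := hQ.exists_sampleSum_midpoint hτ y p q w M h hw h0 h1
  have : sampleSum τ y p ≤ sampleSum τ y r := hp (mem_univ r)
  linarith

namespace IsTransformation

theorem continuous_comp_dist (hτ : IsTransformation τ) (y : Q) :
    Continuous fun q => τ (dist y q) :=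
  hτ.continuousOn.comp_continuous (by fun_prop) fun _ => dist_nonneg

theorem continuous_sampleSum (hτ : IsTransformation τ) (y : ι → Q) :
    Continuous (sampleSum τ y) :=
  continuous_finsetSum _ fun j _ => hτ.continuous_comp_dist (y j)

theorem sampleSum_nonneg (hτ : IsTransformation τ) (y : ι → Q) (q : Q) : 0 ≤ sampleSum τ y q :=
  Finset.sum_nonneg fun _ _ => hτ.nonneg dist_nonneg

theorem dist_le_of_sampleSum_le (hτ : IsTransformation τ) {y : ι → Q} {q : Q} {A : ℝ}
    (h : sampleSum τ y q ≤ A) (j : ι) : dist (y j) q ≤ 1 + A / deriv τ 1 := by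
  have hA : 0 ≤ A := (hτ.sampleSum_nonneg y q).trans h
  have hl := hτ.deriv_pos 1 one_pos
  rcases le_total (dist (y j) q) 1 with h1 | h1
  · exact h1.trans (le_add_of_nonneg_right (by positivity))
  · have h2 : τ (dist (y j) q) ≤ sampleSum τ y q :=
      Finset.single_le_sum (f := fun j => τ (dist (y j) q)) (fun _ _ => hτ.nonneg dist_nonneg)
        (Finset.mem_univ j)
    have h3 := hτ.deriv_one_mul_le le_rfl h1
    have h4 := hτ.nonneg zero_le_one
    have : dist (y j) q - 1 ≤ A / deriv τ 1 := by
      rw [le_div_iff₀ hl]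
      linarith
    linarith

theorem abs_comp_dist_sub_le (hτ : IsTransformation τ) {L : ℝ}
    (hL : ∀ x, 0 < x → deriv τ x ≤ L) (hL0 : 0 ≤ L) (y p q : Q) :
    |τ (dist y p) - τ (dist y q)| ≤ L * dist p q :=
  (hτ.abs_sub_le_mul hL dist_nonneg dist_nonneg).trans
    (mul_le_mul_of_nonneg_left
      (by rw [dist_comm y p, dist_comm y q]; exact abs_dist_sub_le p q y) hL0)

theorem abs_sampleSum_sub_le (hτ : IsTransformation τ) {L : ℝ}
    (hL : ∀ x, 0 < x → deriv τ x ≤ L) (hL0 : 0 ≤ L) (y y' : ι → Q) (q : Q) :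
    |sampleSum τ y q - sampleSum τ y' q| ≤ L * ∑ j, dist (y j) (y' j) := by
  rw [sampleSum, sampleSum, ← Finset.sum_sub_distrib, Finset.mul_sum]
  refine (Finset.abs_sum_le_sum_abs _ _).trans (Finset.sum_le_sum fun j _ => ?_)
  rw [dist_comm (y j) q, dist_comm (y' j) q]
  exact hτ.abs_comp_dist_sub_le hL hL0 q (y j) (y' j)

end IsTransformation

/-- The sample objective functions are uniformly convex on their sublevel sets. -/
theorem IsHadamard.exists_uniform_convexity [Nonempty ι] (hQ : IsHadamard Q)
    (hτ : IsTransformation τ) (hpos : ∀ x : ℝ, 0 < x → 0 < ddtran τ x) (A : ℝ) :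
    ∃ c, 0 < c ∧ ∀ (y : ι → Q) (q₀ q₁ : Q) (b : ℝ), sampleSum τ y q₀ ≤ A →
      sampleSum τ y q₁ ≤ A → (∀ q, b ≤ sampleSum τ y q) →
      c * dist q₀ q₁ ^ 2 ≤ 1 / 2 * sampleSum τ y q₀ + 1 / 2 * sampleSum τ y q₁ - b := by
  obtain ⟨w, hw, hwM⟩ := hτ.exists_curvatureBound_pos hpos (1 + A / deriv τ 1)
  refine ⟨(∑ _j : ι, w) / 8, ?_, fun y q₀ q₁ b h0 h1 hb => ?_⟩
  · have : 0 < ∑ _j : ι, w := Finset.sum_pos (fun _ _ => hw) Finset.univ_nonempty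
    positivity
  · obtain ⟨p, hp⟩ := hQ.exists_sampleSum_midpoint hτ y q₀ q₁ (fun _ => w) _ (fun _ => hwM)
      (fun _ => hw.le) (hτ.dist_le_of_sampleSum_le h0) (hτ.dist_le_of_sampleSum_le h1)
    linarith [hb p]

/-- Uniform convexity makes minimizing sequences Cauchy, so completeness replaces compactness. -/
theorem IsHadamard.exists_isMinOn_sampleSum [Nonempty ι] (hQ : IsHadamard Q)
    (hτ : IsTransformation τ) (hpos : ∀ x : ℝ, 0 < x → 0 < ddtran τ x) (y : ι → Q) :
    ∃ p, IsMinOn (sampleSum τ y) univ p := by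
  have : CompleteSpace Q := hQ.1
  have : Nonempty Q := ⟨y (Classical.arbitrary ι)⟩
  have hbdd : BddBelow (range (sampleSum τ y)) := ⟨0, by
    rintro _ ⟨q, rfl⟩
    exact hτ.sampleSum_nonneg y q⟩
  set b := ⨅ q, sampleSum τ y q with hb
  have hbq : ∀ q, b ≤ sampleSum τ y q := ciInf_le hbdd
  obtain ⟨c, hc, hconv⟩ := hQ.exists_uniform_convexity (ι := ι) hτ hpos (b + 1)
  have hex : ∀ k : ℕ, ∃ q, sampleSum τ y q < b + 1 / ((k : ℝ) + 1) := fun k =>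
    exists_lt_of_ciInf_lt (lt_add_of_pos_right _ Nat.one_div_pos_of_nat)
  choose u hu using hex
  have hu' : ∀ k N : ℕ, N ≤ k → sampleSum τ y (u k) ≤ b + 1 / ((N : ℝ) + 1) := fun k N h =>
    (hu k).le.trans (by gcongr)
  have hu1 : ∀ k, sampleSum τ y (u k) ≤ b + 1 := fun k => by simpa using hu' k 0 k.zero_le
  have hlim : Tendsto (fun N : ℕ => (1 : ℝ) / ((N : ℝ) + 1)) atTop (𝓝 0) :=
    tendsto_one_div_add_atTop_nhds_zero_nat
  have hcauchy : CauchySeq u := by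
    refine cauchySeq_of_le_tendsto_0 (fun N : ℕ => √(c⁻¹ * (1 / ((N : ℝ) + 1)))) ?_ ?_
    · intro k l N hk hl
      refine Real.le_sqrt_of_sq_le ?_
      rw [← div_eq_inv_mul, le_div_iff₀ hc]
      linarith [hconv y (u k) (u l) b (hu1 k) (hu1 l) hbq, hu' k N hk, hu' l N hl]
    · simpa using ((hlim.const_mul c⁻¹).sqrt)
  obtain ⟨p, hp⟩ := cauchySeq_tendsto_of_complete hcauchy
  refine ⟨p, fun q _ => (?_ : sampleSum τ y p ≤ b).trans (hbq q)⟩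
  refine le_of_tendsto_of_tendsto (((hτ.continuous_sampleSum y).tendsto p).comp hp)
    (by simpa using hlim.const_add b) (Eventually.of_forall fun k => (hu k).le)

theorem IsHadamard.isMinOn_sampleSum_unique [Nonempty ι] (hQ : IsHadamard Q)
    (hτ : IsTransformation τ) (hpos : ∀ x : ℝ, 0 < x → 0 < ddtran τ x) {y : ι → Q} {p q : Q}
    (hp : IsMinOn (sampleSum τ y) univ p) (hq : IsMinOn (sampleSum τ y) univ q) : p = q := by
  have hpq : sampleSum τ y q ≤ sampleSum τ y p := hq (mem_univ p)
  obtain ⟨c, hc, hconv⟩ := hQ.exists_uniform_convexity (ι := ι) hτ hpos (sampleSum τ y p)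
  have h := hconv y p q _ le_rfl hpq fun r => hp (mem_univ r)
  have h0 : dist p q ^ 2 ≤ 0 := by
    by_contra! h0
    nlinarith [mul_pos hc h0]
  exact dist_eq_zero.1 (pow_eq_zero_iff two_ne_zero |>.1 (le_antisymm h0 (sq_nonneg _)))

/-- The minimizer of the sample objective function depends continuously on the sample. -/
theorem IsHadamard.exists_continuous_minimizer [Nonempty ι] (hQ : IsHadamard Q)
    (hτ : IsTransformation τ) (hpos : ∀ x : ℝ, 0 < x → 0 < ddtran τ x) {L : ℝ}
    (hL : ∀ x, 0 < x → deriv τ x ≤ L) (hL0 : 0 ≤ L) :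
    ∃ M : (ι → Q) → Q, Continuous M ∧ ∀ y, IsMinOn (sampleSum τ y) univ (M y) := by
  choose M hM using hQ.exists_isMinOn_sampleSum (ι := ι) hτ hpos
  refine ⟨M, continuous_iff_continuousAt.2 fun y => ?_, hM⟩
  obtain ⟨c, hc, hconv⟩ :=
    hQ.exists_uniform_convexity (ι := ι) hτ hpos (sampleSum τ y (M y) + 1)
  have hη : Tendsto (fun y' : ι → Q => L * ∑ j, dist (y j) (y' j)) (𝓝 y) (𝓝 0) := by
    have : Continuous fun y' : ι → Q => L * ∑ j, dist (y j) (y' j) := by fun_prop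
    simpa using this.tendsto y
  rw [ContinuousAt, tendsto_iff_dist_tendsto_zero]
  refine squeeze_zero' (Eventually.of_forall fun _ => dist_nonneg) ?_
    (by simpa using (hη.const_mul c⁻¹).sqrt :
      Tendsto (fun y' : ι → Q => √(c⁻¹ * (L * ∑ j, dist (y j) (y' j)))) (𝓝 y) (𝓝 0))
  -- Two changes of sample cost at most 1/2 each, which keeps `M y'` in the sublevel set at height 1
  -- above the minimum.
  filter_upwards [hη.eventually_le_const (by norm_num : (0 : ℝ) < 1 / 2)] with y' hy'
  have h1 := (abs_le.1 (hτ.abs_sampleSum_sub_le hL hL0 y y' (M y'))).2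
  have h2 := (abs_le.1 (hτ.abs_sampleSum_sub_le hL hL0 y y' (M y))).1
  have h3 : sampleSum τ y' (M y') ≤ sampleSum τ y' (M y) := hM y' (mem_univ _)
  have h4 := hconv y (M y') (M y) _ (by linarith) (by linarith) fun q => hM y (mem_univ q)
  refine Real.le_sqrt_of_sq_le ?_
  rw [← div_eq_inv_mul, le_div_iff₀ hc]
  linarith

/-- If most of the sample is close to `m`, then so is every point that beats `m`. -/
theorem dist_le_of_sampleSum_le (hτ : IsTransformation τ) {L : ℝ}
    (hL : ∀ x, 0 < x → deriv τ x ≤ L) {y : ι → Q} {m q : Q} {ρ : ℝ} [Nonempty ι]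
    (hq : sampleSum τ y q ≤ sampleSum τ y m) (hρ : 1 ≤ ρ)
    (hcard : ((Finset.univ.filter fun j => ρ < dist (y j) m).card : ℝ) ≤
      deriv τ 1 / (4 * L) * Fintype.card ι) :
    dist m q ≤ 4 * ρ := by
  by_contra! hD
  have hl := hτ.deriv_pos 1 one_pos
  have hlL := hL 1 one_pos
  have hL0 : 0 < L := hl.trans_le hlL
  set l := deriv τ 1 with hl_def
  set D := dist m q with hD_def
  set N : ℝ := ((Finset.univ.filter fun j => ρ < dist (y j) m).card : ℝ) with hN
  set n : ℝ := (Fintype.card ι : ℝ) with hn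
  have hn0 : 0 < n := Nat.cast_pos.2 Fintype.card_pos
  -- Moving from m to q costs at least l(D - 2ρ) for a nearby observation and gains at most LD for
  -- an outlier; with few outliers the total is positive once D > 4ρ.
  have key : ∀ j, l * (D - 2 * ρ) +
      (if ρ < dist (y j) m then -(L * D) - l * (D - 2 * ρ) else 0) ≤
        τ (dist (y j) q) - τ (dist (y j) m) := by
    intro j
    split_ifs with h
    · have := (abs_le.1 (hτ.abs_comp_dist_sub_le hL hL0.le (y j) q m)).1
      rw [dist_comm q m] at this
      linarith
    · have h1 : τ (dist (y j) m) ≤ τ ρ :=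
        hτ.monotoneOn (mem_Ici.2 dist_nonneg) (mem_Ici.2 (by linarith)) (not_lt.1 h)
      have h2 : D - ρ ≤ dist (y j) q := by
        have := dist_triangle_left m q (y j)
        linarith [not_lt.1 h]
      have h3 := hτ.deriv_one_mul_le hρ (by linarith : ρ ≤ dist (y j) q)
      have h4 := mul_le_mul_of_nonneg_left (by linarith : D - 2 * ρ ≤ dist (y j) q - ρ) hl.le
      linarith
  have hsum := Finset.sum_le_sum fun j (_ : j ∈ Finset.univ) => key j
  rw [Finset.sum_add_distrib, ← Finset.sum_filter, Finset.sum_const, Finset.sum_const,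
    Finset.sum_sub_distrib, nsmul_eq_mul, nsmul_eq_mul, Finset.card_univ, ← hN, ← hn] at hsum
  change _ ≤ sampleSum τ y q - sampleSum τ y m at hsum
  have hN1 : N * L ≤ l * n / 4 := by
    have := mul_le_mul_of_nonneg_right hcard hL0.le
    calc N * L ≤ l / (4 * L) * n * L := this
      _ = l * n / 4 := by field_simp
  have hN0 : 0 ≤ N := Nat.cast_nonneg _
  have hN2 : N * l ≤ l * n / 4 := (mul_le_mul_of_nonneg_left hlL hN0).trans hN1
  have hE : 0 < D - 2 * ρ := by linarith
  have h5 := mul_le_mul_of_nonneg_right hN1 (by linarith : 0 ≤ D)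
  have h6 := mul_le_mul_of_nonneg_right hN2 hE.le
  have h7 : 0 < l * n * (2 * D - 6 * ρ) := mul_pos (mul_pos hl hn0) (by linarith)
  nlinarith

/-- Leave-one-out stability of the sample minimizers. -/
theorem IsHadamard.dist_leaveOneOut_le (hQ : IsHadamard Q) (hτ : IsTransformation τ) {L : ℝ}
    (hL : ∀ x, 0 < x → deriv τ x ≤ L) (hL0 : 0 ≤ L) {n : ℕ} {y : Fin (n + 1) → Q}
    {i : Fin (n + 1)} {m p p' : Q} (hn : 0 < n)
    (hp : IsMinOn (sampleSum τ fun j => y (i.succAbove j)) univ p)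
    (hp' : IsMinOn (sampleSum τ y) univ p') {w ρ : ℝ} (hw : 0 < w)
    (hcurv : CurvatureBound τ w (5 * ρ)) (hpm : dist m p ≤ 4 * ρ) (hpm' : dist m p' ≤ 4 * ρ)
    (hcard : (n : ℝ) / 2 ≤
      (Finset.univ.filter fun j => dist (y (i.succAbove j)) m ≤ ρ).card) :
    dist p p' ≤ 8 * L / (n * w) := by
  set z : Fin n → Q := fun j => y (i.succAbove j) with hz
  -- Observations within ρ of m are within 5ρ of both minimizers and carry weight w; the others get
  -- weight 0, valid for any radius.
  have hgrow := hQ.growth_of_isMinOn hτ hp p'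
    (fun j => if dist (z j) m ≤ ρ then w else 0)
    (fun j => if dist (z j) m ≤ ρ then 5 * ρ else max (dist (z j) p) (dist (z j) p'))
    (fun j => by
      by_cases h : dist (z j) m ≤ ρ
      · simpa [h] using hcurv
      · simpa [h] using hτ.curvatureBound_zero _)
    (fun j => by split_ifs <;> linarith)
    (fun j => by
      split_ifs with h
      · linarith [dist_triangle (z j) m p]
      · exact le_max_left _ _)
    (fun j => by
      split_ifs with h
      · linarith [dist_triangle (z j) m p']
      · exact le_max_right _ _)
  rw [← Finset.sum_filter, Finset.sum_const, nsmul_eq_mul] at hgrow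
  have hmin : sampleSum τ y p' ≤ sampleSum τ y p := hp' (mem_univ p)
  rw [sampleSum, sampleSum, Fin.sum_univ_succAbove _ i, Fin.sum_univ_succAbove _ i] at hmin
  have hlip := (abs_le.1 (hτ.abs_comp_dist_sub_le hL hL0 (y i) p p')).2
  -- Since p' minimizes the full sum, its excess in the reduced sum is paid for by the single term
  -- of `y i`, at most L d(p,p').
  have hle : (n : ℝ) / 2 * w / 4 * dist p p' ^ 2 ≤ L * dist p p' := by
    have h1 : (n : ℝ) / 2 * w / 4 * dist p p' ^ 2 ≤
        ((Finset.univ.filter fun j => dist (z j) m ≤ ρ).card : ℝ) * w / 4 * dist p p' ^ 2 := by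
      gcongr
    simp only [sampleSum, hz] at hgrow h1
    linarith
  have hn' : (0 : ℝ) < n := Nat.cast_pos.2 hn
  rcases (dist_nonneg : 0 ≤ dist p p').eq_or_lt with h | h
  · rw [← h]
    positivity
  · rw [le_div_iff₀ (by positivity)]
    have : (n : ℝ) / 2 * w / 4 * dist p p' ≤ L := by
      refine le_of_mul_le_mul_right ?_ h
      linarith
    linarith

end TransformedFrechet

/-! ### Moment products controlling outliers -/

namespace TransformedFrechet

variable {Q : Type*} [MetricSpace Q] {ι : Type*} [Fintype ι] {τ : ℝ → ℝ}

/-- A multiplicative functional of the sample that controls its order statistics. -/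
noncomputable def momentProd (m : Q) (γ c : ℝ) (y : ι → Q) : ℝ := ∏ j, (1 + c * dist (y j) m ^ γ)

theorem one_le_momentProd (m : Q) (γ : ℝ) {c : ℝ} (hc : 0 ≤ c) (y : ι → Q) :
    1 ≤ momentProd m γ c y :=
  Finset.prod_induction _ (1 ≤ ·) (fun _ _ ha hb => one_le_mul_of_one_le_of_one_le ha hb) le_rfl
    fun _ _ => le_add_of_nonneg_right (by positivity)

theorem momentProd_succAbove_le (m : Q) (γ : ℝ) {c : ℝ} (hc : 0 ≤ c) {n : ℕ}
    (y : Fin (n + 1) → Q) (i : Fin (n + 1)) :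
    momentProd m γ c (fun j => y (i.succAbove j)) ≤ momentProd m γ c y := by
  have h := one_le_momentProd m γ hc fun j => y (i.succAbove j)
  rw [momentProd, momentProd, Fin.prod_univ_succAbove _ i]
  rw [momentProd] at h
  refine le_mul_of_one_le_left (by linarith) (le_add_of_nonneg_right (by positivity))

theorem one_add_pow_card_le_momentProd (m : Q) {γ c ρ : ℝ} (hγ : 0 ≤ γ) (hc : 0 ≤ c)
    (hρ : 0 ≤ ρ) (y : ι → Q) :
    (1 + c * ρ ^ γ) ^ (Finset.univ.filter fun j => ρ < dist (y j) m).card ≤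
      momentProd m γ c y := by
  rw [← Finset.prod_const, Finset.prod_filter]
  refine Finset.prod_le_prod (fun j _ => by split_ifs <;> positivity) fun j _ => ?_
  split_ifs with h
  · gcongr
  · exact le_add_of_nonneg_right (by positivity)

/-- Pointwise control of the squared distance of a near minimizer by a product functional. -/
theorem sq_dist_le_momentProd [Nonempty ι] (hτ : IsTransformation τ) {L : ℝ}
    (hL : ∀ x, 0 < x → deriv τ x ≤ L) {y : ι → Q} {m q : Q} {γ β c : ℝ} {k : ℕ} (hγ : 0 < γ)
    (hq : sampleSum τ y q ≤ sampleSum τ y m) (hk : 0 < k) (hkγ : 2 ≤ k * γ) (hβ : 0 < β)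
    (hβk : 2 * k * β ≤ deriv τ 1 / (4 * L)) (hn : 1 ≤ β * Fintype.card ι)
    (hc : 1 / (Fintype.card ι : ℝ) ≤ c) :
    dist m q ^ 2 ≤ 64 * (1 + (β⁻¹) ^ k) * momentProd m γ c y := by
  have hn0 : (0 : ℝ) < Fintype.card ι := Nat.cast_pos.2 Fintype.card_pos
  have hc0 : 0 < c := (by positivity : (0 : ℝ) < 1 / (Fintype.card ι : ℝ)).trans_le hc
  have hP := one_le_momentProd m γ hc0.le y
  have hβ' : 0 < (β⁻¹) ^ k := by positivity
  rcases le_or_gt (dist m q) 8 with h8 | h8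
  · have : dist m q ^ 2 ≤ 64 := by nlinarith [dist_nonneg (x := m) (y := q)]
    nlinarith
  -- As d(m,q) = 8ρ > 4ρ, the localization bound must fail at ρ, so there are many outliers.
  · set ρ := dist m q / 8 with hρ
    have hρ1 : 1 < ρ := by linarith
    have hcard : 2 * k * β * Fintype.card ι <
        ((Finset.univ.filter fun j => ρ < dist (y j) m).card : ℝ) := by
      by_contra! h
      have := dist_le_of_sampleSum_le hτ hL hq hρ1.le
        (h.trans (mul_le_mul_of_nonneg_right hβk hn0.le))
      linarith
    have hP2 := one_add_pow_card_le_momentProd m hγ.le hc0.le (by linarith : 0 ≤ ρ) y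
    set N := (Finset.univ.filter fun j => ρ < dist (y j) m).card with hN
    have hk' : (0 : ℝ) < k := Nat.cast_pos.2 hk
    have hx : 0 < ρ ^ γ := by positivity
    -- Since N/k > 2β·card, the floor exceeds 2β·card - 1, which is at least β·card.
    have ht : β * Fintype.card ι ≤ ((N / k : ℕ) : ℝ) := by
      have h1 : (N : ℝ) < k * (((N / k : ℕ) : ℝ) + 1) := by
        exact_mod_cast Nat.lt_mul_div_succ N hk
      have h2 : (k : ℝ) * (2 * (β * Fintype.card ι)) < k * (((N / k : ℕ) : ℝ) + 1) := by
        linarith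
      linarith [lt_of_mul_lt_mul_left h2 hk'.le]
    -- Bernoulli on a block of N/k outliers yields one factor βρ^γ; k such blocks give ρ^(kγ) ≥ ρ²
    -- up to a constant.
    have h3 : β * ρ ^ γ ≤ (1 + c * ρ ^ γ) ^ (N / k) := by
      have h4 := one_add_mul_le_pow (by linarith [mul_pos hc0 hx] : -2 ≤ c * ρ ^ γ) (N / k)
      have h5 : β ≤ ((N / k : ℕ) : ℝ) * c := by
        calc β = β * Fintype.card ι * (1 / (Fintype.card ι : ℝ)) := by field_simp
          _ ≤ ((N / k : ℕ) : ℝ) * c := by gcongr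
      have h6 := mul_le_mul_of_nonneg_right h5 hx.le
      linarith
    have h7 : (β * ρ ^ γ) ^ k ≤ momentProd m γ c y :=
      calc (β * ρ ^ γ) ^ k ≤ ((1 + c * ρ ^ γ) ^ (N / k)) ^ k := by gcongr
        _ = (1 + c * ρ ^ γ) ^ (N / k * k) := (pow_mul _ _ _).symm
        _ ≤ (1 + c * ρ ^ γ) ^ N :=
          pow_le_pow_right₀ (le_add_of_nonneg_right (by positivity)) (Nat.div_mul_le_self N k)
        _ ≤ _ := hP2
    have h8 : ρ ^ 2 ≤ (ρ ^ γ) ^ k := by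
      rw [← Real.rpow_natCast ρ 2, ← Real.rpow_mul_natCast (by linarith), mul_comm]
      exact Real.rpow_le_rpow_of_exponent_le hρ1.le (by exact_mod_cast hkγ)
    have h9 : ρ ^ 2 ≤ (β⁻¹) ^ k * momentProd m γ c y := by
      calc ρ ^ 2 ≤ (ρ ^ γ) ^ k := h8
        _ = (β⁻¹) ^ k * (β * ρ ^ γ) ^ k := by
          rw [← mul_pow, inv_mul_cancel_left₀ hβ.ne']
        _ ≤ _ := by gcongr
    have h10 : dist m q = 8 * ρ := by rw [hρ]; ring
    rw [h10]
    nlinarith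

/-- Leave-one-out stability without any restriction on the sample. -/
theorem IsHadamard.dist_leaveOneOut_le_momentProd (hQ : IsHadamard Q) (hτ : IsTransformation τ)
    {L : ℝ} (hL : ∀ x, 0 < x → deriv τ x ≤ L) {n : ℕ} {y : Fin (n + 1) → Q}
    {i : Fin (n + 1)} {m p p' : Q} (hn : 0 < n)
    (hp : IsMinOn (sampleSum τ fun j => y (i.succAbove j)) univ p)
    (hp' : IsMinOn (sampleSum τ y) univ p') {w ρ γ c K : ℝ} (hw : 0 < w) (hρ : 1 ≤ ρ)
    (hcurv : CurvatureBound τ w (5 * ρ)) (hγ : 0 < γ) (hc : 0 ≤ c) (hcρ : c * ρ ^ γ = 1)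
    (hK : dist m p ^ 2 ≤ K) (hK' : dist m p' ^ 2 ≤ K) :
    dist p p' ≤ 8 * L / (n * w) + K / n +
      n * ((2 : ℝ) ^ (-(deriv τ 1 / (4 * L) * n)) * momentProd m γ c y) := by
  have hl := hτ.deriv_pos 1 one_pos
  have hlL := hL 1 one_pos
  have hL0 : 0 < L := hl.trans_le hlL
  have hn' : (0 : ℝ) < n := Nat.cast_pos.2 hn
  have hK0 : 0 ≤ K := (sq_nonneg _).trans hK
  have hP := one_le_momentProd m γ hc y
  set α := deriv τ 1 / (4 * L) with hα
  have hα0 : 0 < α := by positivity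
  have hα4 : α ≤ 1 / 4 := by
    rw [hα, div_le_iff₀ (by positivity)]
    linarith
  rcases le_or_gt ((Finset.univ.filter fun j => ρ < dist (y j) m).card : ℝ) (α * n) with h | h
  · have : Nonempty (Fin n) := ⟨⟨0, hn⟩⟩
    have hsub : ((Finset.univ.filter fun j => ρ < dist (y (i.succAbove j)) m).card : ℝ) ≤
        α * n := by
      refine le_trans (Nat.cast_le.2 ?_) h
      refine Finset.card_le_card_of_injOn i.succAbove (fun j hj => ?_)
        i.succAbove_right_injective.injOn
      simpa using hj
    have h1 : dist m p ≤ 4 * ρ := dist_le_of_sampleSum_le hτ hL (hp (mem_univ m)) hρ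
      (by rwa [Fintype.card_fin])
    have h2 : dist m p' ≤ 4 * ρ := dist_le_of_sampleSum_le hτ hL (hp' (mem_univ m)) hρ
      (by
        rw [Fintype.card_fin]
        exact h.trans (mul_le_mul_of_nonneg_left (by simp) hα0.le))
    have hcard : (n : ℝ) / 2 ≤
        (Finset.univ.filter fun j => dist (y (i.succAbove j)) m ≤ ρ).card := by
      have h3 := Finset.card_filter_add_card_filter_not (s := (Finset.univ : Finset (Fin n)))
        (fun j => dist (y (i.succAbove j)) m ≤ ρ)
      simp only [not_le, Finset.card_univ, Fintype.card_fin] at h3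
      have h4 : ((Finset.univ.filter fun j => dist (y (i.succAbove j)) m ≤ ρ).card : ℝ) +
        (Finset.univ.filter fun j => ρ < dist (y (i.succAbove j)) m).card = n := by
        exact_mod_cast h3
      nlinarith
    have h5 := hQ.dist_leaveOneOut_le hτ hL hL0.le hn hp hp' hw hcurv h1 h2 hcard
    have : 0 ≤ K / n +
      n * ((2 : ℝ) ^ (-(α * n)) * momentProd m γ c y) := by positivity
    linarith
  · have h1 := one_add_pow_card_le_momentProd m hγ.le hc (by linarith : 0 ≤ ρ) y
    rw [hcρ, one_add_one_eq_two, ← Real.rpow_natCast] at h1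
    -- Each of more than αn outliers contributes a factor at least 1 + cρ^γ = 2.
    have h2 : 1 ≤ (2 : ℝ) ^ (-(α * n)) * momentProd m γ c y := by
      rw [Real.rpow_neg two_pos.le, ← div_eq_inv_mul, one_le_div (by positivity)]
      exact (Real.rpow_le_rpow_of_exponent_le one_le_two h.le).trans h1
    have h3 : ∀ x : ℝ, x ^ 2 ≤ K → x ≤ K / n / 2 + n / 2 := by
      intro x hx
      have : x * n ≤ K / 2 + n ^ 2 / 2 := by nlinarith [sq_nonneg (x - n)]
      calc x = x * n / n := by field_simp
        _ ≤ (K / 2 + n ^ 2 / 2) / n := by gcongr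
        _ = _ := by field_simp
    have h4 := dist_triangle_left p p' m
    have h5 := h3 _ hK
    have h6 := h3 _ hK'
    have h7 := mul_le_mul_of_nonneg_left h2 hn'.le
    have h8 : 0 ≤ 8 * L / (n * w) := by positivity
    linarith

/-! ### Measurability and moments of sample functionals -/

section Measurability

variable [MeasurableSpace Q] [BorelSpace Q]

/-- On a product of nonseparable spaces a continuous function need not be measurable for the product
σ-algebra; the sample is therefore moved, up to null sets, into a separable subset. -/
theorem aestronglyMeasurable_comp_pi {Ω : Type*} [MeasurableSpace Ω] {P : Measure Ω}
    {X : ι → Ω → Q} (hX : ∀ i, AEStronglyMeasurable (X i) P) {G : (ι → Q) → ℝ}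
    (hG : Continuous G) : AEStronglyMeasurable (fun ω => G fun i => X i ω) P := by
  set S : Set Q := ⋃ i, range ((hX i).mk (X i)) with hS_def
  have hS : TopologicalSpace.IsSeparable S :=
    .iUnion fun i => (hX i).stronglyMeasurable_mk.isSeparable_range
  have : TopologicalSpace.SeparableSpace S := hS.separableSpace
  have : SecondCountableTopology S := UniformSpace.secondCountable_of_separable S
  let Z : Ω → ι → S := fun ω i => ⟨(hX i).mk (X i) ω, mem_iUnion.2 ⟨i, mem_range_self ω⟩⟩
  have hZ : Measurable Z := measurable_pi_lambda _ fun i =>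
    ((hX i).stronglyMeasurable_mk.measurable).subtype_mk
  have hG' : Measurable fun z : ι → S => G fun i => (z i : Q) :=
    (hG.comp (by fun_prop)).measurable
  refine ⟨fun ω => G fun i => (Z ω i : Q), (hG'.comp hZ).stronglyMeasurable, ?_⟩
  have hae : ∀ᵐ ω ∂P, ∀ i, X i ω = (hX i).mk (X i) ω := ae_all_iff.2 fun i => (hX i).ae_eq_mk
  filter_upwards [hae] with ω hω
  simp only [Z, ← hω]

variable {μ : Measure Q}

theorem aestronglyMeasurable_of_law
    (hμ : ∃ S : Set Q, TopologicalSpace.IsSeparable S ∧ ∀ᵐ y ∂μ, y ∈ S)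
    {Ω : Type*} [MeasurableSpace Ω] {P : Measure Ω} {X : Ω → Q} (hX : HasLaw X μ P) :
    AEStronglyMeasurable X P := by
  obtain ⟨S, hS, hSμ⟩ := hμ
  refine aestronglyMeasurable_iff_aemeasurable_separable.2 ⟨hX.aemeasurable, S, hS, ?_⟩
  rw [← hX.map_eq] at hSμ
  exact ae_of_ae_map hX.aemeasurable hSμ

theorem aestronglyMeasurable_pi [IsProbabilityMeasure μ]
    (hμ : ∃ S : Set Q, TopologicalSpace.IsSeparable S ∧ ∀ᵐ y ∂μ, y ∈ S)
    {G : (ι → Q) → ℝ} (hG : Continuous G) :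
    AEStronglyMeasurable G (Measure.pi fun _ : ι => μ) :=
  aestronglyMeasurable_comp_pi (X := fun i (y : ι → Q) => y i)
    (fun i => aestronglyMeasurable_of_law hμ
      (measurePreserving_eval (fun _ : ι => μ) i).hasLaw) hG

end Measurability

section Moments

variable [MeasurableSpace Q] {μ : Measure Q} [IsProbabilityMeasure μ]

theorem integrable_momentProd {m : Q} {γ : ℝ} (hmom : Integrable (fun y : Q => dist y m ^ γ) μ)
    (c : ℝ) : Integrable (momentProd (ι := ι) m γ c) (Measure.pi fun _ : ι => μ) :=
  Integrable.fintype_prod (f := fun (_ : ι) (x : Q) => 1 + c * dist x m ^ γ)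
    fun _ => (integrable_const 1).add (hmom.const_mul c)

theorem integral_momentProd {m : Q} {γ : ℝ} (hmom : Integrable (fun y : Q => dist y m ^ γ) μ)
    (c : ℝ) : ∫ y, momentProd (ι := ι) m γ c y ∂(Measure.pi fun _ : ι => μ) =
      (1 + c * ∫ y, dist y m ^ γ ∂μ) ^ Fintype.card ι := by
  have h := integral_fintype_prod_eq_pow (ι := ι) (μ := μ) (fun x : Q => 1 + c * dist x m ^ γ)
  rw [integral_add (integrable_const 1) (hmom.const_mul c), integral_const_mul] at h
  simpa [momentProd] using h

end Moments

end TransformedFrechet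

/-! ### Excess risk and the variance inequality -/

namespace TransformedFrechet

variable {Q : Type*} [MetricSpace Q] [MeasurableSpace Q] {τ : ℝ → ℝ} {μ : Measure Q}

/-- The excess of the population objective function at `q` over its value at `m`. -/
noncomputable def excessRisk (τ : ℝ → ℝ) (μ : Measure Q) (m q : Q) : ℝ :=
  ∫ y, (τ (dist y q) - τ (dist y m)) ∂μ

theorem IsTransformation.exists_measurable_ddtran (hτ : IsTransformation τ) :
    ∃ g : ℝ → EReal, Measurable g ∧ ∀ x, 0 < x → g x = ddtran τ x := by
  classical
  refine ⟨fun x => if 0 < x then ddtran τ x else ⊤, Antitone.measurable fun a b hab => ?_,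
    fun x hx => if_pos hx⟩
  by_cases ha : 0 < a
  · simpa only [if_pos ha, if_pos (ha.trans_le hab)] using
      hτ.ddtran_antitoneOn (mem_Ioi.2 ha) (mem_Ioi.2 (ha.trans_le hab)) hab
  · simp only [if_neg ha, le_top]

section ExcessRisk

variable [BorelSpace Q] [IsProbabilityMeasure μ] {L : ℝ}

theorem integrable_comp_dist_sub (hτ : IsTransformation τ) (hL : ∀ x, 0 < x → deriv τ x ≤ L)
    (hL0 : 0 ≤ L) (p q : Q) : Integrable (fun y => τ (dist y p) - τ (dist y q)) μ := by
  refine Integrable.of_bound (C := L * dist p q) ?_ (Eventually.of_forall fun y => ?_)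
  · have h : ∀ p : Q, Continuous fun y => τ (dist y p) := fun p => by
      simpa only [dist_comm] using hτ.continuous_comp_dist p
    exact ((h p).sub (h q)).measurable.aestronglyMeasurable
  · exact hτ.abs_comp_dist_sub_le hL hL0 y p q

theorem IsFrechetMean.excessRisk_nonneg {m : Q} (hm : IsFrechetMean τ μ m)
    (hτ : IsTransformation τ) (hL : ∀ x, 0 < x → deriv τ x ≤ L) (hL0 : 0 ≤ L) (q : Q) :
    0 ≤ excessRisk τ μ m q := by
  obtain ⟨o, ho⟩ := hm
  have h := integral_sub (integrable_comp_dist_sub (μ := μ) hτ hL hL0 q o)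
    (integrable_comp_dist_sub (μ := μ) hτ hL hL0 m o)
  simp only [sub_sub_sub_cancel_right] at h
  rw [excessRisk, h]
  exact sub_nonneg.2 (ho (mem_univ q))

theorem abs_excessRisk_sub_le (hτ : IsTransformation τ) (hL : ∀ x, 0 < x → deriv τ x ≤ L)
    (hL0 : 0 ≤ L) (m p q : Q) :
    |excessRisk τ μ m p - excessRisk τ μ m q| ≤ L * dist p q := by
  rw [excessRisk, excessRisk, ← integral_sub (integrable_comp_dist_sub hτ hL hL0 p m)
    (integrable_comp_dist_sub hτ hL hL0 q m)]
  simp only [sub_sub_sub_cancel_right]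
  have := norm_integral_le_of_norm_le_const (μ := μ) (C := L * dist p q)
    (f := fun y => τ (dist y p) - τ (dist y q)) (Eventually.of_forall fun y => hτ.abs_comp_dist_sub_le hL hL0 y p q)
  simpa using this

theorem continuous_excessRisk (hτ : IsTransformation τ) (hL : ∀ x, 0 < x → deriv τ x ≤ L)
    (hL0 : 0 ≤ L) (m : Q) : Continuous (excessRisk τ μ m) :=
  (LipschitzWith.of_dist_le_mul (K := ⟨L, hL0⟩) fun p q =>
    abs_excessRisk_sub_le hτ hL hL0 m p q).continuous

theorem excessRisk_le (hτ : IsTransformation τ) (hL : ∀ x, 0 < x → deriv τ x ≤ L)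
    (hL0 : 0 ≤ L) (m q : Q) : excessRisk τ μ m q ≤ L * dist m q := by
  have h := (abs_le.1 (abs_excessRisk_sub_le (μ := μ) hτ hL hL0 m q m)).2
  rw [dist_comm m q]
  simpa [excessRisk] using h

/-- Variance inequality for an arbitrary curvature bound on a ball of mass at least `1 / 2`. -/
theorem IsFrechetMean.mul_sq_dist_le {m : Q} (hm : IsFrechetMean τ μ m) (hQ : IsHadamard Q)
    (hτ : IsTransformation τ) (hL : ∀ x, 0 < x → deriv τ x ≤ L) (hL0 : 0 ≤ L) {χ w : ℝ}
    (hχ : 1 / 2 ≤ μ.real {y | dist y m ≤ χ}) (hw : 0 ≤ w) (q : Q)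
    (hcurv : CurvatureBound τ w (χ + dist m q)) :
    dist m q ^ 2 * w ≤ 8 * excessRisk τ μ m q := by
  obtain ⟨p, hp⟩ := hQ.exists_midpoint hτ m q
  have hS : MeasurableSet {y : Q | dist y m ≤ χ} :=
    (isClosed_le (by fun_prop) continuous_const).measurableSet
  -- Curvature w is used on the ball only, and curvature 0 outside.
  have key : ∀ y, {y | dist y m ≤ χ}.indicator (fun _ => w / 8 * dist m q ^ 2) y ≤
      1 / 2 * (τ (dist y q) - τ (dist y m)) - (τ (dist y p) - τ (dist y m)) := by
    intro y
    by_cases hy : dist y m ≤ χ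
    · rw [indicator_of_mem (by exact hy)]
      have := hp y w _ hcurv hw (hy.trans (le_add_of_nonneg_right dist_nonneg))
        ((dist_triangle y m q).trans (by gcongr))
      linarith
    · rw [indicator_of_notMem (by exact hy)]
      have := hp y 0 _ (hτ.curvatureBound_zero _) le_rfl (le_max_left _ (dist y q))
        (le_max_right _ _)
      linarith
  have h := integral_mono ((integrable_const _).indicator hS)
    (((integrable_comp_dist_sub (μ := μ) hτ hL hL0 q m).const_mul (1 / 2)).sub
      (integrable_comp_dist_sub hτ hL hL0 p m)) key
  simp only [Pi.sub_apply] at h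
  rw [integral_sub ((integrable_comp_dist_sub hτ hL hL0 q m).const_mul _)
    (integrable_comp_dist_sub hτ hL hL0 p m), integral_const_mul, integral_indicator_const _ hS,
    smul_eq_mul] at h
  have h1 : 0 ≤ excessRisk τ μ m p := hm.excessRisk_nonneg hτ hL hL0 p
  have h2 := mul_le_mul_of_nonneg_right hχ (by positivity : 0 ≤ w / 8 * dist m q ^ 2)
  simp only [excessRisk] at h1 ⊢
  linarith

/-- The radius χ + d(m,q) is at most twice the larger of χ and d(m,q), so the minimum is an
admissible curvature. -/
theorem IsFrechetMean.sq_dist_mul_ddtran_le {m : Q} (hm : IsFrechetMean τ μ m)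
    (hQ : IsHadamard Q) (hτ : IsTransformation τ) (hL : ∀ x, 0 < x → deriv τ x ≤ L)
    (hL0 : 0 ≤ L) {χ : ℝ} (hχ0 : 0 ≤ χ) (hχ : 1 / 2 ≤ μ.real {y | dist y m ≤ χ}) (q : Q) :
    0 ≤ dist m q ^ 2 * (min (ddtran τ (2 * χ)) (ddtran τ (2 * dist m q))).toReal ∧
    dist m q ^ 2 * (min (ddtran τ (2 * χ)) (ddtran τ (2 * dist m q))).toReal ≤
      8 * excessRisk τ μ m q := by
  have hmin : 0 ≤ min (ddtran τ (2 * χ)) (ddtran τ (2 * dist m q)) :=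
    le_min (hτ.ddtran_nonneg (by positivity)) (hτ.ddtran_nonneg (by positivity))
  have hW := EReal.toReal_nonneg hmin
  refine ⟨by positivity, ?_⟩
  rcases (dist_nonneg (x := m) (y := q)).eq_or_lt with h0 | h0
  · rw [← h0]
    simpa using hm.excessRisk_nonneg hτ hL hL0 q
  · refine hm.mul_sq_dist_le hQ hτ hL hL0 hχ hW q ?_
    have hcoe : ((min (ddtran τ (2 * χ)) (ddtran τ (2 * dist m q))).toReal : EReal) =
        min (ddtran τ (2 * χ)) (ddtran τ (2 * dist m q)) :=
      EReal.coe_toReal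
        ((min_le_right _ _).trans_lt (hτ.ddtran_lt_top (by positivity))).ne
        (EReal.bot_lt_zero.trans_le hmin).ne'
    rcases le_total χ (dist m q) with h | h
    · exact (hτ.curvatureBound (by positivity) (hcoe.le.trans (min_le_right _ _))).mono le_rfl
        (by linarith)
    · exact (hτ.curvatureBound (by linarith : 0 < 2 * χ) (hcoe.le.trans (min_le_left _ _))).mono
        le_rfl (by linarith)

end ExcessRisk

/-- Evaluating the loss of a leave-one-out estimator at the left-out observation gives the
excess risk. -/
theorem integral_leaveOneOut [IsProbabilityMeasure μ] {n : ℕ} (M : (Fin n → Q) → Q) (m : Q)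
    (i : Fin (n + 1))
    (hint : Integrable (fun y : Fin (n + 1) → Q =>
      τ (dist (y i) (M fun j => y (i.succAbove j))) - τ (dist (y i) m))
      (Measure.pi fun _ => μ)) :
    ∫ y : Fin (n + 1) → Q, (τ (dist (y i) (M fun j => y (i.succAbove j))) - τ (dist (y i) m))
      ∂(Measure.pi fun _ => μ) = ∫ z, excessRisk τ μ m (M z) ∂(Measure.pi fun _ => μ) := by
  have hmp := measurePreserving_piFinSuccAbove (fun _ : Fin (n + 1) => μ) i
  let H : Q × (Fin n → Q) → ℝ := fun x => τ (dist x.1 (M x.2)) - τ (dist x.1 m)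
  have hH : Integrable H (μ.prod (Measure.pi fun _ => μ)) :=
    (hmp.integrable_comp_emb (MeasurableEquiv.measurableEmbedding _)).1 hint
  have h1 := hmp.integral_comp' H
  have h2 := integral_prod_symm H hH
  exact h1.trans h2

/-! ### Leave-one-out bound and the rate 1/n -/

section Rate

variable [BorelSpace Q] [IsProbabilityMeasure μ]

/-- The expected excess risk of the sample minimizer is at most the mean leave-one-out
displacement, for which an integrable upper bound `B` is available. -/
theorem integral_excessRisk_le (hτ : IsTransformation τ) {L : ℝ}
    (hL : ∀ x, 0 < x → deriv τ x ≤ L) (hL0 : 0 ≤ L)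
    (hμ : ∃ S : Set Q, TopologicalSpace.IsSeparable S ∧ ∀ᵐ y ∂μ, y ∈ S) {n : ℕ} {m : Q}
    {M : (Fin n → Q) → Q} {M' : (Fin (n + 1) → Q) → Q} (hM : Continuous M)
    (hM' : ∀ y, IsMinOn (sampleSum τ y) univ (M' y)) {A B : (Fin (n + 1) → Q) → ℝ}
    (hA : Integrable A (Measure.pi fun _ => μ)) (hB : Integrable B (Measure.pi fun _ => μ))
    (hMA : ∀ y i, dist (M fun j => y (Fin.succAbove i j)) m ≤ A y)
    (hMB : ∀ y i, dist (M fun j => y (Fin.succAbove i j)) (M' y) ≤ B y) :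
    ∫ z, excessRisk τ μ m (M z) ∂(Measure.pi fun _ => μ) ≤
      L * ∫ y, B y ∂(Measure.pi fun _ => μ) := by
  have hint : ∀ i, Integrable (fun y : Fin (n + 1) → Q =>
      τ (dist (y i) (M fun j => y (i.succAbove j))) - τ (dist (y i) m))
      (Measure.pi fun _ => μ) := by
    intro i
    refine (hA.const_mul L).mono' (aestronglyMeasurable_pi hμ ?_)
      (Eventually.of_forall fun y => ?_)
    · have h : ∀ f : (Fin (n + 1) → Q) → Q, Continuous f →
          Continuous fun y => τ (dist (y i) (f y)) := fun f hf =>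
        hτ.continuousOn.comp_continuous (by fun_prop) fun _ => dist_nonneg
      exact (h _ (hM.comp (by fun_prop))).sub (h _ continuous_const)
    · exact (hτ.abs_comp_dist_sub_le hL hL0 (y i) _ m).trans
        (mul_le_mul_of_nonneg_left (hMA y i) hL0)
  have hsum : ∀ y : Fin (n + 1) → Q,
      ∑ i, (τ (dist (y i) (M fun j => y (i.succAbove j))) - τ (dist (y i) m)) ≤
        ((n : ℝ) + 1) * (L * B y) := by
    intro y
    have h1 : ∑ i, (τ (dist (y i) (M fun j => y (i.succAbove j))) - τ (dist (y i) (M' y))) ≤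
        ∑ _i : Fin (n + 1), L * B y := Finset.sum_le_sum fun i _ =>
      ((abs_le.1 (hτ.abs_comp_dist_sub_le hL hL0 (y i) _ _)).2).trans
        (mul_le_mul_of_nonneg_left (hMB y i) hL0)
    have h2 : sampleSum τ y (M' y) ≤ sampleSum τ y m := hM' y (mem_univ m)
    rw [Finset.sum_sub_distrib] at h1 ⊢
    simp only [Finset.sum_const, Finset.card_univ, Fintype.card_fin, nsmul_eq_mul, Nat.cast_add,
      Nat.cast_one] at h1
    simp only [sampleSum] at h2
    linarith
  have h := integral_mono (integrable_finsetSum _ fun i _ => hint i)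
    ((hB.const_mul L).const_mul ((n : ℝ) + 1)) hsum
  rw [integral_finsetSum _ fun i _ => hint i, integral_const_mul, integral_const_mul] at h
  simp only [integral_leaveOneOut M m _ (hint _), Finset.sum_const, Finset.card_univ,
    Fintype.card_fin, nsmul_eq_mul, Nat.cast_add, Nat.cast_one] at h
  exact le_of_mul_le_mul_left h (by positivity)

/-- The excess risk of the sample minimizer is of order `1 / n`. -/
theorem exists_integral_excessRisk_le (hQ : IsHadamard Q) (hτ : IsTransformation τ)
    (hpos : ∀ x : ℝ, 0 < x → 0 < ddtran τ x) {L : ℝ} (hL : ∀ x, 0 < x → deriv τ x ≤ L)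
    (hμ : ∃ S : Set Q, TopologicalSpace.IsSeparable S ∧ ∀ᵐ y ∂μ, y ∈ S) {m : Q} {γ : ℝ}
    (hγ : 0 < γ) (hmom : Integrable (fun y : Q => dist y m ^ γ) μ) :
    ∃ (n₀ : ℕ) (C : ℝ), 0 < n₀ ∧ 0 < C ∧ ∀ n : ℕ, n₀ ≤ n → ∃ M : (Fin n → Q) → Q,
      Continuous M ∧ (∀ y, IsMinOn (sampleSum τ y) univ (M y)) ∧
      Integrable (fun y => dist m (M y)) (Measure.pi fun _ => μ) ∧
      ∫ y, excessRisk τ μ m (M y) ∂(Measure.pi fun _ => μ) ≤ C / n := by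
  have hl := hτ.deriv_pos 1 one_pos
  have hL0 : 0 < L := hl.trans_le (hL 1 one_pos)
  set α := deriv τ 1 / (4 * L) with hα
  have hα0 : 0 < α := by positivity
  set E := ∫ y, dist y m ^ γ ∂μ with hE
  have hE0 : 0 ≤ E := integral_nonneg fun y => by positivity
  obtain ⟨k, hk⟩ := exists_nat_gt (2 / γ)
  have hk' : (0 : ℝ) < k := (by positivity : 0 < 2 / γ).trans hk
  have hk0 : 0 < k := Nat.cast_pos.1 hk'
  have hkγ : 2 ≤ k * γ := ((div_lt_iff₀ hγ).1 hk).le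
  set β := α / (2 * k) with hβ
  have hβ0 : 0 < β := by positivity
  have hβk : 2 * k * β ≤ α := by
    rw [hβ]
    field_simp
    rfl
  set K := 64 * (1 + (β⁻¹) ^ k) with hK
  have hK0 : 0 < K := by positivity
  have h2α : 0 < (2 : ℝ) ^ α - 1 := sub_pos.2 (Real.one_lt_rpow one_lt_two hα0)
  -- This c makes (1 + cE)/2^α < 1, so 2^(-αn) beats the growth of the expected product; ρ is then
  -- fixed by cρ^γ = 1.
  set c := min 1 (((2 : ℝ) ^ α - 1) / (2 * (E + 1))) with hc
  have hc0 : 0 < c := lt_min one_pos (by positivity)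
  have hcE : c * E < (2 : ℝ) ^ α - 1 := by
    have h1 : c ≤ ((2 : ℝ) ^ α - 1) / (2 * (E + 1)) := min_le_right _ _
    rw [le_div_iff₀ (by positivity)] at h1
    nlinarith
  set ρ := c ^ (-γ⁻¹) with hρ
  have hρ1 : 1 ≤ ρ :=
    Real.one_le_rpow_of_pos_of_le_one_of_nonpos hc0 (min_le_left _ _) (by
      rw [neg_nonpos]; positivity)
  have hcρ : c * ρ ^ γ = 1 := by
    rw [hρ, ← Real.rpow_mul hc0.le, neg_mul, inv_mul_cancel₀ hγ.ne', Real.rpow_neg_one,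
      mul_inv_cancel₀ hc0.ne']
  obtain ⟨w, hw0, hw⟩ := hτ.exists_curvatureBound_pos hpos (5 * ρ)
  set r := (1 + c * E) / (2 : ℝ) ^ α with hr
  have hr0 : 0 ≤ r := by positivity
  have hr1 : r < 1 := by
    rw [hr, div_lt_one (by positivity)]
    linarith
  obtain ⟨R, hR⟩ : ∃ R, ∀ n : ℕ, (n : ℝ) ^ 2 * r ^ n ≤ R := by
    obtain ⟨R, hR⟩ := (tendsto_pow_const_mul_const_pow_of_abs_lt_one 2
      (by rwa [abs_of_nonneg hr0])).bddAbove_range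
    exact ⟨R, fun n => hR (mem_range_self n)⟩
  have hR0 : 0 ≤ R := by simpa using hR 0
  -- n ≥ β⁻¹ gives βn ≥ 1; the extra 1 in n₀ excludes empty samples.
  obtain ⟨n₁, hn₁⟩ := exists_nat_ge β⁻¹
  refine ⟨n₁ + 1, L * (8 * L / w + K * Real.exp (2 * E) + R * (1 + c * E)), n₁.succ_pos,
    by positivity, fun n hn => ?_⟩
  have hn0 : 0 < n := n₁.succ_pos.trans_le hn
  have hn' : (0 : ℝ) < n := Nat.cast_pos.2 hn0
  have : Nonempty (Fin n) := ⟨⟨0, hn0⟩⟩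
  have hβn : 1 ≤ β * n := by
    have : β⁻¹ ≤ n := hn₁.trans (Nat.cast_le.2 (n₁.le_succ.trans hn))
    rwa [inv_le_iff_one_le_mul₀' hβ0] at this
  obtain ⟨M, hMc, hM⟩ := hQ.exists_continuous_minimizer (ι := Fin n) hτ hpos hL hL0.le
  obtain ⟨M', -, hM'⟩ := hQ.exists_continuous_minimizer (ι := Fin (n + 1)) hτ hpos hL hL0.le
  -- Here c = 1/n, for which the expected product (1 + E/n)^(n+1) stays below exp(2E).
  have hsq : ∀ y, dist m (M y) ^ 2 ≤ K * momentProd m γ (1 / (n : ℝ)) y := fun y =>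
    sq_dist_le_momentProd hτ hL hγ (hM y (mem_univ m)) hk0 hkγ hβ0 hβk
      (by rwa [Fintype.card_fin]) (by rw [Fintype.card_fin])
  have hsq' : ∀ y, dist m (M' y) ^ 2 ≤ K * momentProd m γ (1 / (n : ℝ)) y := fun y =>
    sq_dist_le_momentProd hτ hL hγ (hM' y (mem_univ m)) hk0 hkγ hβ0 hβk
      (by
        rw [Fintype.card_fin]
        exact hβn.trans (mul_le_mul_of_nonneg_left (by simp) hβ0.le))
      (by
        rw [Fintype.card_fin]
        exact one_div_le_one_div_of_le hn' (by simp))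
  have hle : ∀ x b : ℝ, x ^ 2 ≤ b → x ≤ 1 + b := fun x b h => by nlinarith [sq_nonneg (x - 1)]
  have hninv : (0 : ℝ) ≤ 1 / n := by positivity
  have hsqi : ∀ (y : Fin (n + 1) → Q) (i : Fin (n + 1)),
      dist m (M fun j => y (i.succAbove j)) ^ 2 ≤ K * momentProd m γ (1 / (n : ℝ)) y :=
    fun y i => (hsq _).trans
      (mul_le_mul_of_nonneg_left (momentProd_succAbove_le m γ hninv y i) hK0.le)
  refine ⟨M, hMc, hM, ?_, ?_⟩
  · refine ((integrable_const 1).add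
      ((integrable_momentProd (ι := Fin n) hmom (1 / (n : ℝ))).const_mul K)).mono'
      (aestronglyMeasurable_pi hμ (by fun_prop)) (Eventually.of_forall fun y => ?_)
    rw [Real.norm_of_nonneg dist_nonneg]
    exact hle _ _ (hsq y)
  · have hint1 := integrable_momentProd (ι := Fin (n + 1)) hmom (1 / (n : ℝ))
    have hint2 := integrable_momentProd (ι := Fin (n + 1)) hmom c
    have hBint1 : Integrable (fun y : Fin (n + 1) → Q => 8 * L / (n * w) +
        K * momentProd m γ (1 / (n : ℝ)) y / n) (Measure.pi fun _ => μ) :=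
      (integrable_const _).add ((hint1.const_mul K).div_const _)
    have hBint2 : Integrable (fun y : Fin (n + 1) → Q => n * ((2 : ℝ) ^ (-(α * n)) *
        momentProd m γ c y)) (Measure.pi fun _ => μ) := (hint2.const_mul _).const_mul _
    have hmain := integral_excessRisk_le (μ := μ) (m := m) hτ hL hL0.le hμ hMc hM'
      (A := fun y => 1 + K * momentProd m γ (1 / (n : ℝ)) y)
      (B := fun y => 8 * L / (n * w) + K * momentProd m γ (1 / (n : ℝ)) y / n +
        n * ((2 : ℝ) ^ (-(α * n)) * momentProd m γ c y))
      ((integrable_const 1).add (hint1.const_mul K)) (hBint1.add hBint2)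
      (fun y i => by rw [dist_comm]; exact hle _ _ (hsqi y i))
      (fun y i => hQ.dist_leaveOneOut_le_momentProd hτ hL hn0 (hM _) (hM' y) hw0 hρ1 hw hγ
        hc0.le hcρ (hsqi y i) (hsq' y))
    refine hmain.trans ?_
    rw [integral_add hBint1 hBint2,
      integral_add (integrable_const _) ((hint1.const_mul K).div_const _), integral_const, integral_div,
      integral_const_mul, integral_const_mul, integral_const_mul, integral_momentProd hmom,
      integral_momentProd hmom, Fintype.card_fin, ← hE]
    simp only [probReal_univ, one_smul]
    rw [mul_div_assoc L]
    refine mul_le_mul_of_nonneg_left ?_ hL0.le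
    have hexp : (1 + 1 / (n : ℝ) * E) ^ (n + 1) ≤ Real.exp (2 * E) := by
      calc (1 + 1 / (n : ℝ) * E) ^ (n + 1) ≤ Real.exp (1 / (n : ℝ) * E) ^ (n + 1) := by
            gcongr
            rw [add_comm]
            exact Real.add_one_le_exp _
        _ = Real.exp (((n + 1 : ℕ) : ℝ) * (1 / (n : ℝ) * E)) := (Real.exp_nat_mul _ _).symm
        _ ≤ Real.exp (2 * E) := by
            refine Real.exp_le_exp.2 ?_
            have h1 : ((n + 1 : ℕ) : ℝ) * (1 / (n : ℝ)) ≤ 2 := by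
              rw [mul_one_div, div_le_iff₀ hn']
              have : (1 : ℝ) ≤ n := by exact_mod_cast hn0
              push_cast
              linarith
            rw [← mul_assoc]
            exact mul_le_mul_of_nonneg_right h1 hE0
    have hgeo : n * ((2 : ℝ) ^ (-(α * n)) * (1 + c * E) ^ (n + 1)) ≤ R * (1 + c * E) / n := by
      have h1 : (2 : ℝ) ^ (-(α * n)) * (1 + c * E) ^ (n + 1) = r ^ n * (1 + c * E) := by
        rw [hr, div_pow, ← Real.rpow_mul_natCast two_pos.le, Real.rpow_neg two_pos.le, pow_succ]
        field_simp
      rw [h1, le_div_iff₀ hn']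
      calc n * (r ^ n * (1 + c * E)) * n = (n : ℝ) ^ 2 * r ^ n * (1 + c * E) := by ring
        _ ≤ R * (1 + c * E) := by gcongr; exact hR n
    calc _ ≤ 8 * L / (n * w) + K * Real.exp (2 * E) / n + R * (1 + c * E) / n := by gcongr
      _ = _ := by field_simp

end Rate

end TransformedFrechet

/-! ### Assembly of the main theorem -/

theorem mainTheorem9 {Q : Type*} [MetricSpace Q] [MeasurableSpace Q] [BorelSpace Q]
    (hQ : TransformedFrechet.IsHadamard Q)
    (τ : ℝ → ℝ) (hτ : TransformedFrechet.IsTransformation τ)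
    (hτ_bdd : limsup (fun x : ℝ => ((TransformedFrechet.dtran τ x : ℝ) : EReal)) atTop < ⊤)
    (hτ_pos : ∀ x : ℝ, 0 < x → 0 < TransformedFrechet.ddtran τ x)
    -- the distribution of `Y`; it is carried by a separable set
    (μ : Measure Q) [IsProbabilityMeasure μ]
    (hμ_sep : ∃ S : Set Q, TopologicalSpace.IsSeparable S ∧ ∀ᵐ y ∂μ, y ∈ S)
    (m : Q) (hm : TransformedFrechet.IsFrechetMean τ μ m)
    (γ : ℝ) (hγ : 0 < γ) (hmoment : Integrable (fun y : Q => dist y m ^ γ) μ) :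
    ∃ (n₀ : ℕ) (C : ℝ), 0 < C ∧
      ∀ n : ℕ, n₀ ≤ n →
      ∀ χ : ℝ, TransformedFrechet.IsMedian (μ.map (fun y : Q => dist y m)) χ →
      ∀ (Ω : Type*) [MeasurableSpace Ω] (P : Measure Ω) [IsProbabilityMeasure P]
        (Y : Fin n → Ω → Q), (∀ i, HasLaw (Y i) μ P) → iIndepFun Y P →
      ∀ mn : Ω → Q,
        (∀ᵐ ω ∂P, TransformedFrechet.IsSampleFrechetMean τ (fun i => Y i ω) (mn ω)) →
        Integrable (fun ω => dist m (mn ω) ^ 2 *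
          (min (TransformedFrechet.ddtran τ (2 * χ))
            (TransformedFrechet.ddtran τ (2 * dist m (mn ω)))).toReal) P ∧
        ∫ ω, dist m (mn ω) ^ 2 *
          (min (TransformedFrechet.ddtran τ (2 * χ))
            (TransformedFrechet.ddtran τ (2 * dist m (mn ω)))).toReal ∂P ≤ C / n := by
  obtain ⟨L, hL0, hL⟩ := hτ.exists_deriv_le hτ_bdd
  obtain ⟨n₀, C, hn₀, hC, hrate⟩ :=
    TransformedFrechet.exists_integral_excessRisk_le hQ hτ hτ_pos hL hμ_sep hγ hmoment
  refine ⟨n₀, 8 * C, by positivity, fun n hn χ hχ Ω _ P _ Y hY hindep mn hmn => ?_⟩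
  have : Nonempty (Fin n) := ⟨⟨0, hn₀.trans_le hn⟩⟩
  obtain ⟨M, hMc, hM, hMint, hMrate⟩ := hrate n hn
  have hdist : Measurable fun y : Q => dist y m := by fun_prop
  have hχm : 1 / 2 ≤ μ {y | dist y m ≤ χ} := by
    have := hχ.1
    rwa [Measure.map_apply hdist measurableSet_Iic] at this
  have hχ0 : 0 ≤ χ := by
    by_contra! h
    have : {y : Q | dist y m ≤ χ} = ∅ :=
      eq_empty_of_forall_notMem fun y hy => absurd (dist_nonneg.trans hy) h.not_ge
    simp [this] at hχm
  have hχr : 1 / 2 ≤ μ.real {y | dist y m ≤ χ} := by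
    have := ENNReal.toReal_mono (measure_ne_top μ _) hχm
    simpa [Measure.real] using this
  have hlaw : HasLaw (fun ω i => Y i ω) (Measure.pi fun _ => μ) P := by
    refine ⟨aemeasurable_pi_lambda _ fun i => (hY i).aemeasurable, ?_⟩
    rw [(iIndepFun_iff_map_fun_eq_pi_map fun i => (hY i).aemeasurable).1 hindep]
    simp only [(hY _).map_eq]
  have hYm : ∀ i, AEStronglyMeasurable (Y i) P := fun i =>
    TransformedFrechet.aestronglyMeasurable_of_law hμ_sep (hY i)
  -- Uniqueness identifies the arbitrary selection `mn` with the continuous minimizer, which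
  -- supplies its measurability.
  have hmnM : ∀ᵐ ω ∂P, mn ω = M fun i => Y i ω := by
    filter_upwards [hmn] with ω hω
    exact hQ.isMinOn_sampleSum_unique hτ hτ_pos hω (hM _)
  set Ψ : ℝ → ℝ := fun d => d ^ 2 * (min (TransformedFrechet.ddtran τ (2 * χ))
    (TransformedFrechet.ddtran τ (2 * d))).toReal with hΨ
  have hD : AEMeasurable (fun ω => dist m (mn ω)) P := by
    have h := TransformedFrechet.aestronglyMeasurable_comp_pi hYm
      (G := fun y => dist m (M y)) (by fun_prop)
    refine (h.congr ?_).aemeasurable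
    filter_upwards [hmnM] with ω hω
    rw [hω]
  have hΨm : AEStronglyMeasurable (fun ω => Ψ (dist m (mn ω))) P := by
    obtain ⟨g, hg, hgeq⟩ := hτ.exists_measurable_ddtran
    have h : AEMeasurable (fun ω => dist m (mn ω) ^ 2 *
        (min (TransformedFrechet.ddtran τ (2 * χ)) (g (2 * dist m (mn ω)))).toReal) P :=
      (hD.pow_const 2).mul
        ((measurable_const.min (hg.comp (measurable_const_mul 2))).ereal_toReal.comp_aemeasurable hD)
    refine h.aestronglyMeasurable.congr (Eventually.of_forall fun ω => ?_)
    -- At distance 0, `g` may differ from τ''₊, but the factor d² vanishes.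
    rcases (dist_nonneg (x := m) (y := mn ω)).eq_or_lt with h0 | h0
    · simp [hΨ, ← h0]
    · simp only [hΨ]
      rw [hgeq _ (by positivity)]
  have hrisk : AEStronglyMeasurable (TransformedFrechet.excessRisk τ μ m ∘ M)
      (Measure.pi fun _ => μ) := TransformedFrechet.aestronglyMeasurable_pi hμ_sep
    ((TransformedFrechet.continuous_excessRisk hτ hL hL0.le m).comp hMc)
  have hriskint : Integrable (TransformedFrechet.excessRisk τ μ m ∘ M)
      (Measure.pi fun _ => μ) := by
    refine (hMint.const_mul L).mono' hrisk (Eventually.of_forall fun y => ?_)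
    rw [Function.comp_apply, Real.norm_of_nonneg (hm.excessRisk_nonneg hτ hL hL0.le _)]
    exact TransformedFrechet.excessRisk_le hτ hL hL0.le m _
  have hbound : ∀ᵐ ω ∂P, 0 ≤ Ψ (dist m (mn ω)) ∧ Ψ (dist m (mn ω)) ≤
      8 * (TransformedFrechet.excessRisk τ μ m ∘ M) (fun i => Y i ω) := by
    filter_upwards [hmnM] with ω hω
    rw [Function.comp_apply, ← hω]
    exact hm.sq_dist_mul_ddtran_le hQ hτ hL hL0.le hχ0 hχr (mn ω)
  have hint : Integrable (fun ω =>
      8 * (TransformedFrechet.excessRisk τ μ m ∘ M) (fun i => Y i ω)) P := by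
    refine Integrable.const_mul ?_ 8
    rw [← hlaw.map_eq] at hriskint
    exact hriskint.comp_aemeasurable hlaw.aemeasurable
  have hΨint : Integrable (fun ω => Ψ (dist m (mn ω))) P := by
    refine hint.mono' hΨm ?_
    filter_upwards [hbound] with ω hω
    rw [Real.norm_of_nonneg hω.1]
    exact hω.2
  refine ⟨hΨint, ?_⟩
  calc ∫ ω, Ψ (dist m (mn ω)) ∂P
      ≤ ∫ ω, 8 * (TransformedFrechet.excessRisk τ μ m ∘ M) (fun i => Y i ω) ∂P :=
        integral_mono_ae hΨint hint (hbound.mono fun ω hω => hω.2)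
    _ = 8 * ∫ y, (TransformedFrechet.excessRisk τ μ m ∘ M) y ∂(Measure.pi fun _ => μ) := by
        rw [integral_const_mul]
        congr 1
        exact hlaw.integral_comp hrisk
    _ ≤ 8 * (C / n) := mul_le_mul_of_nonneg_left hMrate (by norm_num)
    _ = 8 * C / n := by ring
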